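/- An interval exchange transformation (IET) is a bijection $f:[0,1)\to[0,1)$ for which there is a finite partition of $[0,1)$ into half-open intervals $[u,v)$ on each of which $f$ is a translation; the IETs form a group $\mathcal G$ under composition. A circle rotation is an element of $\mathcal G$ of the form $x\mapsto x+\alpha \bmod 1$ with $\alpha\in\mathbb R$. An action of a group $\Gamma$ by IETs, that is, a homomorphism $\rho:\Gamma\to\mathcal G$, is called faithful if $\rho$ is injective, and totally minimal if for every finite index subgroup $H\le\Gamma$ and every $x\in[0,1)$ the orbit $\{\rho(h)(x): h\in H\}$ is dense in $[0,1)$. Let $\Gamma$ be a virtually abelian group (that is, with an abelian subgroup of finite index) that contains a subgroup isomorphic to $\mathbb Z^2$. Then every faithful totally minimal action $\rho:\Gamma\to\mathcal G$ is conjugate in $\mathcal G$ to an action by circle rotations: there is $\varphi\in\mathcal G$ such that $\varphi\circ\rho(\gamma)\circ\varphi^{-1}$ is a circle rotation for every $\gamma\in\Gamma$. -/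

import Mathlib

namespace IntervalExchange

/-- The half-open unit interval `[0,1)`, with the topology induced by `ℝ`. -/
abbrev UnitIco : Type := Set.Ico (0 : ℝ) 1

/-- A bijection `f` of `[0,1)` is an interval exchange transformation: there is a finite partition
of `[0,1)` into half-open intervals `[u i, v i)` such that `f` is a translation on each of them. -/
def IsIET (f : Equiv.Perm UnitIco) : Prop :=
  ∃ (r : ℕ) (u v t : Fin r → ℝ),
    (∀ i, u i < v i) ∧
    (∀ i j, i ≠ j → Disjoint (Set.Ico (u i) (v i)) (Set.Ico (u j) (v j))) ∧
    (⋃ i, Set.Ico (u i) (v i)) = Set.Ico (0 : ℝ) 1 ∧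
    ∀ i, ∀ x : UnitIco, (x : ℝ) ∈ Set.Ico (u i) (v i) → ((f x : UnitIco) : ℝ) = (x : ℝ) + t i

/-- The number of intervals may be counted by any finite type, and empty intervals may occur. -/
theorem isIET_of_finite {ι : Type} [Finite ι] (f : Equiv.Perm UnitIco) (u v t : ι → ℝ)
    (hd : ∀ i j, i ≠ j → Disjoint (Set.Ico (u i) (v i)) (Set.Ico (u j) (v j)))
    (hU : (⋃ i, Set.Ico (u i) (v i)) = Set.Ico (0 : ℝ) 1)
    (hf : ∀ i, ∀ x : UnitIco, (x : ℝ) ∈ Set.Ico (u i) (v i) →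
      ((f x : UnitIco) : ℝ) = (x : ℝ) + t i) : IsIET f := by
  obtain ⟨r, ⟨e⟩⟩ := Finite.exists_equiv_fin {i : ι // u i < v i}
  refine ⟨r, fun i => u (e.symm i), fun i => v (e.symm i), fun i => t (e.symm i),
    fun i => (e.symm i).2, fun i j hij => hd _ _ ?_, ?_, fun i => hf _⟩
  · intro h
    exact hij (e.symm.injective (Subtype.ext h))
  · rw [← hU]
    ext x
    simp only [Set.mem_iUnion]
    constructor
    · rintro ⟨i, hi⟩
      exact ⟨_, hi⟩
    · rintro ⟨i, hi⟩
      refine ⟨e ⟨i, lt_of_le_of_lt hi.1 hi.2⟩, ?_⟩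
      simpa using hi

theorem isIET_one : IsIET 1 := by
  refine isIET_of_finite (ι := Unit) 1 (fun _ => 0) (fun _ => 1) (fun _ => 0) ?_ ?_ ?_
  · intro i j h
    exact absurd (Subsingleton.elim i j) h
  · exact Set.iUnion_const _
  · intro i x _
    exact (add_zero _).symm

theorem IsIET.mul {f g : Equiv.Perm UnitIco} (hf : IsIET f) (hg : IsIET g) : IsIET (f * g) := by
  obtain ⟨r, u, v, t, -, hd, hU, ht⟩ := hf
  obtain ⟨r', u', v', t', -, hd', hU', ht'⟩ := hg
  have key : ∀ (i : Fin r) (j : Fin r') (x : ℝ),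
      x ∈ Set.Ico (max (u' j) (u i - t' j)) (min (v' j) (v i - t' j)) ↔
        x ∈ Set.Ico (u' j) (v' j) ∧ x + t' j ∈ Set.Ico (u i) (v i) := by
    intro i j x
    simp only [Set.mem_Ico, max_le_iff, lt_min_iff, sub_le_iff_le_add, lt_sub_iff_add_lt]
    tauto
  refine isIET_of_finite (ι := Fin r × Fin r') (f * g)
    (fun p => max (u' p.2) (u p.1 - t' p.2)) (fun p => min (v' p.2) (v p.1 - t' p.2))
    (fun p => t' p.2 + t p.1) ?_ ?_ ?_
  · rintro ⟨i, j⟩ ⟨i', j'⟩ hne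
    rw [Set.disjoint_left]
    intro x hx hx'
    rw [key] at hx hx'
    have hj : j = j' := by
      by_contra h
      exact Set.disjoint_left.1 (hd' j j' h) hx.1 hx'.1
    subst hj
    have hi : i = i' := by
      by_contra h
      exact Set.disjoint_left.1 (hd i i' h) hx.2 hx'.2
    exact hne (by rw [hi])
  · ext x
    simp only [Set.mem_iUnion, key]
    constructor
    · rintro ⟨p, hp, -⟩
      rw [← hU']
      exact Set.mem_iUnion.2 ⟨_, hp⟩
    · intro hx
      obtain ⟨j, hj⟩ := Set.mem_iUnion.1 (hU'.ge hx)
      have h1 := ht' j ⟨x, hx⟩ hj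
      obtain ⟨i, hi⟩ := Set.mem_iUnion.1 (hU.ge (g ⟨x, hx⟩).2)
      exact ⟨(i, j), hj, by rw [h1] at hi; exact hi⟩
  · rintro ⟨i, j⟩ x hx
    rw [key] at hx
    have h1 := ht' j x hx.1
    have h2 := ht i (g x) (by rw [h1]; exact hx.2)
    rw [Equiv.Perm.mul_apply, h2, h1]
    ring

theorem IsIET.inv {f : Equiv.Perm UnitIco} (hf : IsIET f) : IsIET f⁻¹ := by
  obtain ⟨r, u, v, t, -, hd, hU, ht⟩ := hf
  have key : ∀ (i : Fin r) (y : ℝ), y ∈ Set.Ico (u i + t i) (v i + t i) →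
      ∃ x : UnitIco, (x : ℝ) ∈ Set.Ico (u i) (v i) ∧ ((f x : UnitIco) : ℝ) = y ∧
        (x : ℝ) = y - t i := by
    intro i y hy
    have h1 : y - t i ∈ Set.Ico (u i) (v i) := ⟨by linarith [hy.1], by linarith [hy.2]⟩
    have h2 : y - t i ∈ Set.Ico (0 : ℝ) 1 := by
      rw [← hU]
      exact Set.mem_iUnion.2 ⟨i, h1⟩
    refine ⟨⟨y - t i, h2⟩, h1, ?_, rfl⟩
    rw [ht i ⟨y - t i, h2⟩ h1]
    simp
  refine isIET_of_finite f⁻¹ (fun i => u i + t i) (fun i => v i + t i) (fun i => - t i) ?_ ?_ ?_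
  · intro i j hij
    rw [Set.disjoint_left]
    intro y hy hy'
    obtain ⟨x, hx, hxy, -⟩ := key i y hy
    obtain ⟨x', hx', hxy', -⟩ := key j y hy'
    have : x = x' := f.injective (Subtype.ext (hxy.trans hxy'.symm))
    subst this
    exact Set.disjoint_left.1 (hd i j hij) hx hx'
  · ext y
    simp only [Set.mem_iUnion]
    constructor
    · rintro ⟨i, hi⟩
      obtain ⟨x, -, hxy, -⟩ := key i y hi
      rw [← hxy]
      exact (f x).2
    · intro hy
      obtain ⟨x, hx⟩ := f.surjective ⟨y, hy⟩
      obtain ⟨i, hi⟩ := Set.mem_iUnion.1 (hU.ge x.2)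
      have h1 := ht i x hi
      rw [hx] at h1
      simp only at h1
      exact ⟨i, by rw [h1]; linarith [hi.1], by rw [h1]; linarith [hi.2]⟩
  · intro i y hy
    obtain ⟨x, -, hxy, hx⟩ := key i y hy
    have : f x = y := Subtype.ext hxy
    have h2 : f⁻¹ y = x := by rw [← this]; exact f.symm_apply_apply x
    rw [h2, hx]
    ring

/-- The group of all interval exchange transformations of `[0,1)`, under composition. -/
def IETGroup : Subgroup (Equiv.Perm UnitIco) where
  carrier := {f | IsIET f}
  one_mem' := isIET_one
  mul_mem' := IsIET.mul
  inv_mem' := IsIET.inv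

/-- `f` is the circle rotation `x ↦ x + α mod 1` for some `α`, on the fundamental domain `[0,1)`. -/
def IsRotation (f : IETGroup) : Prop :=
  ∃ α : ℝ, ∀ x : UnitIco, ((f.1 x : UnitIco) : ℝ) = Int.fract ((x : ℝ) + α)

/-- `Γ` has an abelian subgroup of finite index. -/
def IsVirtuallyAbelian (Γ : Type*) [Group Γ] : Prop :=
  ∃ H : Subgroup Γ, H.FiniteIndex ∧ ∀ a ∈ H, ∀ b ∈ H, a * b = b * a

/-- `Γ` has a subgroup isomorphic to `ℤ × ℤ`. -/
def ContainsZSquared (Γ : Type*) [Group Γ] : Prop :=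
  ∃ H : Subgroup Γ, Nonempty (Multiplicative (ℤ × ℤ) ≃* H)

/-- Under the action `ρ` of `Γ` by interval exchanges, every orbit of the subgroup `H`
is dense in `[0,1)`. -/
def ActsMinimally {Γ : Type*} [Group Γ] (ρ : Γ →* IETGroup) (H : Subgroup Γ) : Prop :=
  ∀ x : UnitIco, Dense {y : UnitIco | ∃ γ ∈ H, (ρ γ).1 x = y}

/-- Every finite index subgroup of `Γ` acts minimally on `[0,1)`. -/
def IsTotallyMinimal {Γ : Type*} [Group Γ] (ρ : Γ →* IETGroup) : Prop :=
  ∀ H : Subgroup Γ, H.FiniteIndex → ActsMinimally ρ H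

/-- Two actions of `Γ` by interval exchanges are conjugate by an interval exchange. -/
def AreConjugate {Γ : Type*} [Group Γ] (ρ σ : Γ →* IETGroup) : Prop :=
  ∃ φ : IETGroup, ∀ γ : Γ, σ γ = φ * ρ γ * φ⁻¹

end IntervalExchange

namespace IntervalExchange

open Filter Topology

/-! ### Intertwining two actions that differ at finitely many points for each element -/

section Commensurated

variable {G X : Type*} [Group G]

/-! An interval exchange acts on right germs, where it is the given permutation of `[0,1)`, and on
left germs (`leftAction`). With left germs indexed by the same points, the two permutations differ
at finitely many points, and they coincide exactly for maps continuous on the circle, that is, for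
rotations (`isRotation_of_leftAction_eq`).

Suppose a finitely supported permutation `τ` intertwines the two actions of `Γ`. Cut the circle and
reglue the left germ at `x` to the right germ at `τ x`: now `Γ` acts continuously on a finite union
of circles. A finite index subgroup preserves each component, so total minimality leaves only one
(`locally_constant_eq_of_isTotallyMinimal`). Laying its pieces end to end is an interval exchange
onto the standard circle (`exists_iet_leftAction_eq`), and it conjugates the action to a continuous
one, hence to rotations.

The map `τ` comes from `ℤ²` (`exists_finite_support_intertwiner`). A normal abelian subgroup of
finite index contains `f`, `g` spanning `ℤ²`; by minimality and faithfulness this `ℤ²` acts freely.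
Comparing the two actions along `f`-orbits gives `τ`. Its support is finite because a moved
half-orbit of `f` would spread along `g` to infinitely many `f`-orbits, each of which must meet one
finite set. -/

theorem eventually_pow_apply_notMem (mu : G →* Equiv.Perm X) (f : G)
    (hfree : ∀ (m : ℤ) (x : X), mu (f ^ m) x = x → m = 0) (x : X) {E : Set X} (hE : E.Finite) :
    ∀ᶠ n : ℕ in atTop, mu (f ^ n) x ∉ E := by
  have hinj : Function.Injective fun n : ℕ => mu (f ^ n) x := by
    intro m n h
    have h1 := hfree ((m : ℤ) - n) (mu (f ^ n) x) (by
      rw [← Equiv.Perm.mul_apply, ← map_mul, ← zpow_natCast, ← zpow_add]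
      simpa using h)
    omega
  have := hinj.tendsto_cofinite.eventually hE.eventually_cofinite_notMem
  rwa [Nat.cofinite_eq_atTop] at this

theorem exists_eventually_pow_eq (lam mu : G →* Equiv.Perm X) (f : G)
    (hfin : {x | lam f x ≠ mu f x}.Finite)
    (hfree : ∀ (m : ℤ) (x : X), lam (f ^ m) x = x → m = 0) (x : X) :
    ∃ t, ∀ᶠ n : ℕ in atTop, lam (f ^ n) x = mu (f ^ n) t := by
  obtain ⟨N, hN⟩ := eventually_atTop.1 (eventually_pow_apply_notMem lam f hfree x hfin)
  -- Past time `N` the orbit avoids the points where `lam f` and `mu f` differ, so `mu (f ^ n)⁻¹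
  -- (lam (f ^ n) x)` no longer changes.
  refine ⟨(mu (f ^ N))⁻¹ (lam (f ^ N) x), eventually_atTop.2 ⟨N, fun n hn => ?_⟩⟩
  induction n, hn using Nat.le_induction with
  | base => simp
  | succ n hn ih =>
    have h := hN n hn
    simp only [ne_eq, Set.mem_ofPred_eq, not_not] at h
    rw [pow_succ', map_mul, map_mul, Equiv.Perm.mul_apply, Equiv.Perm.mul_apply, h, ih]

/-- An equivariant map is determined by its restriction to a cofinite set. -/
theorem eq_of_eventually_pow_eq (lam mu : G →* Equiv.Perm X) (f : G)
    (hfree : ∀ (m : ℤ) (x : X), lam (f ^ m) x = x → m = 0) (σ : X → X)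
    (hσ : ∀ x, σ (lam f x) = mu f (σ x)) (hfin : {x | σ x ≠ x}.Finite) {x t : X}
    (ht : ∀ᶠ n : ℕ in atTop, lam (f ^ n) x = mu (f ^ n) t) : σ x = t := by
  have hp : ∀ n : ℕ, σ (lam (f ^ n) x) = mu (f ^ n) (σ x) := by
    intro n
    induction n with
    | zero => simp
    | succ n ih =>
      rw [pow_succ', map_mul, map_mul, Equiv.Perm.mul_apply, Equiv.Perm.mul_apply, hσ, ih]
  obtain ⟨n, h1, h2⟩ := (ht.and (eventually_pow_apply_notMem lam f hfree x hfin)).exists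
  simp only [ne_eq, Set.mem_ofPred_eq, not_not] at h2
  rw [hp, h1] at h2
  exact (mu (f ^ n)).injective h2

/-- `τ x` is the eventual value of `mu (f ^ n)⁻¹ (lam (f ^ n) x)`; exchanging `lam` and `mu` gives
the inverse. An `h` commuting with `f` passes through this limit because `lam h` and `mu h` agree
far along the orbit. -/
theorem exists_equivariant_perm (lam mu : G →* Equiv.Perm X) (f : G)
    (hfin : ∀ h, {x | lam h x ≠ mu h x}.Finite)
    (hlam : ∀ (m : ℤ) (x : X), lam (f ^ m) x = x → m = 0)
    (hmu : ∀ (m : ℤ) (x : X), mu (f ^ m) x = x → m = 0) :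
    ∃ τ : Equiv.Perm X, (∀ x, ∀ᶠ n : ℕ in atTop, lam (f ^ n) x = mu (f ^ n) (τ x)) ∧
      ∀ h, Commute h f → ∀ x, τ (lam h x) = mu h (τ x) := by
  choose τ hτ using exists_eventually_pow_eq lam mu f (hfin f) hlam
  have hfin' : ∀ h, {x | mu h x ≠ lam h x}.Finite := fun h => by simpa [ne_comm] using hfin h
  have hbij : Function.Bijective τ := by
    constructor
    · intro x y hxy
      obtain ⟨n, h1, h2⟩ := ((hτ x).and (hτ y)).exists
      rw [hxy, ← h2] at h1
      exact (lam (f ^ n)).injective h1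
    · intro r
      obtain ⟨x, hx⟩ := exists_eventually_pow_eq mu lam f (hfin' f) hmu r
      obtain ⟨n, h1, h2⟩ := ((hτ x).and hx).exists
      refine ⟨x, ?_⟩
      rw [← h2] at h1
      exact ((mu (f ^ n)).injective h1).symm
  refine ⟨Equiv.ofBijective τ hbij, hτ, fun h hc x => ?_⟩
  obtain ⟨n, h1, h2, h3⟩ := ((hτ x).and ((hτ (lam h x)).and
    (eventually_pow_apply_notMem lam f hlam x (hfin h)))).exists
  simp only [ne_eq, Set.mem_ofPred_eq, not_not] at h3
  have hcn : Commute h (f ^ n) := hc.pow_right n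
  rw [← Equiv.Perm.mul_apply, ← map_mul, ← hcn.eq, map_mul, Equiv.Perm.mul_apply, h3, h1,
    ← Equiv.Perm.mul_apply, ← map_mul, hcn.eq, map_mul, Equiv.Perm.mul_apply] at h2
  exact ((mu (f ^ n)).injective h2).symm

/-- If two actions of `G` on `X` differ at finitely many points for each element of `G`, and a
copy of `ℤ²` in an abelian normal subgroup is free in both, then they are conjugate by
a permutation of finite support. -/
theorem exists_finite_support_intertwiner (lam mu : G →* Equiv.Perm X)
    (hfin : ∀ h, {x | lam h x ≠ mu h x}.Finite) (A : Subgroup G) [A.Normal]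
    (hA : ∀ a ∈ A, ∀ b ∈ A, a * b = b * a) (f g : G) (hf : f ∈ A) (hg : g ∈ A)
    (hlam : ∀ (m n : ℤ) (x : X), lam (f ^ m * g ^ n) x = x → m = 0 ∧ n = 0)
    (hmu : ∀ (m n : ℤ) (x : X), mu (f ^ m * g ^ n) x = x → m = 0 ∧ n = 0) :
    ∃ τ : Equiv.Perm X, {x | τ x ≠ x}.Finite ∧ ∀ h x, τ (lam h x) = mu h (τ x) := by
  have hlamf : ∀ (m : ℤ) (x : X), lam (f ^ m) x = x → m = 0 :=
    fun m x h => (hlam m 0 x (by simpa using h)).1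
  have hmuf : ∀ (m : ℤ) (x : X), mu (f ^ m) x = x → m = 0 :=
    fun m x h => (hmu m 0 x (by simpa using h)).1
  have hlamf' : ∀ (m : ℤ) (x : X), lam (f⁻¹ ^ m) x = x → m = 0 :=
    fun m x h => by simpa using hlamf (-m) x (by simpa using h)
  have hfg : Commute f g := hA f hf g hg
  obtain ⟨τ, hτ, hcomm⟩ := exists_equivariant_perm lam mu f hfin hlamf hmuf
  have hstep : ∀ h, Commute h f → ∀ x, lam h x = mu h x → τ x ≠ x → τ (lam h x) ≠ lam h x := by
    intro h hc x hx hne heq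
    rw [hcomm h hc, hx] at heq
    exact hne ((mu h).injective heq)
  -- If the forward orbit misses the disagreement set of `f`, the sequence defining `τ x` is
  -- constantly `x`.
  have hhit : ∀ x, τ x ≠ x → ∃ n : ℕ, lam (f ^ n) x ∈ {y | lam f y ≠ mu f y} := by
    intro x hx
    by_contra! hno
    simp only [ne_eq, Set.mem_ofPred_eq, not_not] at hno
    have h1 : ∀ n : ℕ, lam (f ^ n) x = mu (f ^ n) x := by
      intro n
      induction n with
      | zero => simp
      | succ n ih =>
        rw [pow_succ', map_mul, map_mul, Equiv.Perm.mul_apply, Equiv.Perm.mul_apply, hno, ih]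
    obtain ⟨n, hn⟩ := (hτ x).exists
    rw [h1 n] at hn
    exact hx ((mu (f ^ n)).injective hn).symm
  have hback : ∀ e, {n : ℕ | τ (lam (f⁻¹ ^ n) e) ≠ lam (f⁻¹ ^ n) e}.Finite := by
    intro e
    by_contra hinf
    -- Once past the disagreement set of `f⁻¹`, one moved point makes all later ones moved, by
    -- `hstep`.
    have hall : ∀ᶠ n : ℕ in atTop, τ (lam (f⁻¹ ^ n) e) ≠ lam (f⁻¹ ^ n) e := by
      obtain ⟨N, hN⟩ := eventually_atTop.1
        (eventually_pow_apply_notMem lam f⁻¹ hlamf' e (hfin f⁻¹))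
      obtain ⟨M, hM, hNM⟩ := (Set.not_finite.1 hinf |>.exists_gt N)
      refine eventually_atTop.2 ⟨M, fun n hn => ?_⟩
      induction n, hn using Nat.le_induction with
      | base => exact hM
      | succ n hn ih =>
        have h := hN n (by omega)
        simp only [ne_eq, Set.mem_ofPred_eq, not_not] at h
        have h2 := hstep f⁻¹ (Commute.refl f).inv_left _ h ih
        rwa [← Equiv.Perm.mul_apply (lam _), ← map_mul, ← pow_succ'] at h2
    -- `g` carries the moved half-orbit to a parallel one, up to finitely many points.
    have hk : ∀ k : ℕ, ∀ᶠ n : ℕ in atTop,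
        τ (lam (g ^ k) (lam (f⁻¹ ^ n) e)) ≠ lam (g ^ k) (lam (f⁻¹ ^ n) e) := by
      intro k
      induction k with
      | zero => simpa using hall
      | succ k ih =>
        have hcgf : ∀ n : ℕ, lam (f⁻¹ ^ n) (lam (g ^ k) e) = lam (g ^ k) (lam (f⁻¹ ^ n) e) := by
          intro n
          have : Commute (f⁻¹ ^ n) (g ^ k) := (hfg.inv_left.pow_left n).pow_right k
          rw [← Equiv.Perm.mul_apply, ← Equiv.Perm.mul_apply, ← map_mul, ← map_mul, this.eq]
        filter_upwards [ih, eventually_pow_apply_notMem lam f⁻¹ hlamf' (lam (g ^ k) e) (hfin g)]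
          with n h1 h2
        simp only [ne_eq, not_not] at h2
        rw [hcgf] at h2
        have h3 := hstep g hfg.symm _ h2 h1
        rwa [← Equiv.Perm.mul_apply (lam _), ← map_mul, ← pow_succ'] at h3
    have hk' : ∀ k : ℕ, ∃ m : ℤ, lam (f ^ m * g ^ k) e ∈ {y | lam f y ≠ mu f y} := by
      intro k
      obtain ⟨n, hn⟩ := (hk k).exists
      obtain ⟨m, hm⟩ := hhit _ hn
      refine ⟨(m : ℤ) - n, ?_⟩
      have : f ^ m * (g ^ k * f⁻¹ ^ n) = f ^ ((m : ℤ) - n) * g ^ k := by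
        have hc : Commute (g ^ k) (f⁻¹ ^ n) := ((hfg.inv_left.pow_left n).pow_right k).symm
        rw [hc.eq, zpow_sub, zpow_natCast, zpow_natCast, inv_pow, mul_assoc]
      rwa [← Equiv.Perm.mul_apply, ← map_mul, ← Equiv.Perm.mul_apply, ← map_mul, mul_assoc, this] at hm
    -- Infinitely many `k` and a finite target: two of the points `f ^ m k * g ^ k` applied to `e`
    -- coincide, against freeness.
    choose m hm using hk'
    have : Finite {y | lam f y ≠ mu f y} := hfin f
    obtain ⟨k, k', hne, heq⟩ := Finite.exists_ne_map_eq_of_infinite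
      fun k : ℕ => (⟨_, hm k⟩ : {y | lam f y ≠ mu f y})
    have heq := congrArg Subtype.val heq
    simp only at heq
    have h1 : lam (f ^ (m k' - m k) * g ^ ((k' : ℤ) - k)) e = e := by
      have hc : Commute (f ^ (- m k)) (g ^ (k' : ℤ)) := (hfg.zpow_left _).zpow_right _
      have : f ^ (m k' - m k) * g ^ ((k' : ℤ) - k)
          = (f ^ (m k) * g ^ k)⁻¹ * (f ^ (m k') * g ^ k') := by
        have hc2 : Commute ((g ^ k)⁻¹) (f ^ (m k' - m k)) :=
          ((hfg.zpow_left _).pow_right k).symm.inv_left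
        have hc3 : Commute ((g ^ k)⁻¹) (g ^ k') := ((Commute.refl g).pow_pow k k').inv_left
        rw [zpow_sub g, zpow_natCast, zpow_natCast, mul_inv_rev, ← hc3.eq, ← mul_assoc,
          ← hc2.eq, ← zpow_neg, sub_eq_neg_add, zpow_add]
        group
      rw [this, map_mul, Equiv.Perm.mul_apply, ← heq, map_inv]
      exact (lam (f ^ m k * g ^ k)).symm_apply_apply e
    have := (hlam _ _ _ h1).2
    omega
  have hsupp : {x | τ x ≠ x}.Finite := by
    refine ((hfin f).biUnion fun e _ => (hback e).image fun n => lam (f⁻¹ ^ n) e).subset ?_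
    intro x hx
    obtain ⟨n, hn⟩ := hhit x hx
    have h1 : lam (f⁻¹ ^ n) (lam (f ^ n) x) = x := by
      rw [← Equiv.Perm.mul_apply, ← map_mul]
      simp
    refine Set.mem_biUnion hn ⟨n, ?_, h1⟩
    simpa only [Set.mem_ofPred_eq, h1] using hx
  refine ⟨τ, hsupp, fun h x => ?_⟩
  -- For arbitrary `h`, the conjugate `mu h ∘ τ ∘ lam h⁻¹` also intertwines `f`, since `h⁻¹ * f * h`
  -- lies in `A` and commutes with `f`. It is the identity off a finite set, so it equals `τ`.
  have key := eq_of_eventually_pow_eq lam mu f hlamf (fun y => mu h (τ (lam h⁻¹ y))) ?_ ?_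
    (hτ (lam h x))
  · rw [← key]
    simp
  · intro y
    have hconj : h⁻¹ * f * h ∈ A := by
      simpa using (inferInstance : A.Normal).conj_mem f hf h⁻¹
    have h1 : lam h⁻¹ (lam f y) = lam (h⁻¹ * f * h) (lam h⁻¹ y) := by
      simp [Equiv.Perm.mul_apply]
    rw [h1, hcomm _ (hA _ hconj _ hf)]
    simp [Equiv.Perm.mul_apply]
  · have hi : Function.Injective fun y => lam h⁻¹ y := (lam h⁻¹).injective
    refine ((hsupp.preimage hi.injOn).union ((hfin h).preimage hi.injOn)).subset ?_
    intro y hy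
    by_contra hcon
    simp only [ne_eq, Set.preimage_ofPred_eq, Set.mem_union, Set.mem_ofPred_eq, not_or,
      not_not] at hcon hy
    rw [hcon.1, ← hcon.2] at hy
    simp at hy

end Commensurated

end IntervalExchange

namespace IntervalExchange

open Filter Topology

/-! ### Left and right germs, and the action on left germs -/

section Germs

/-- Left germs of `[0,1)` are based at the points of `(0,1]`; the left germ at `1` is indexed
by `0`. -/
noncomputable def leftPt (x : UnitIco) : ℝ := if (x : ℝ) = 0 then 1 else x

/-- The filter of left neighbourhoods of `leftPt x`. -/
noncomputable def leftGerm (x : UnitIco) : Filter UnitIco :=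
  comap Subtype.val (𝓝[<] leftPt x)

/-- The filter of right neighbourhoods of `x`, including `x`. -/
noncomputable def rightGerm (x : UnitIco) : Filter UnitIco :=
  comap Subtype.val (𝓝[≥] (x : ℝ))

theorem leftPt_of_ne_zero {x : UnitIco} (h : (x : ℝ) ≠ 0) : leftPt x = x := if_neg h

theorem leftPt_of_eq_zero {x : UnitIco} (h : (x : ℝ) = 0) : leftPt x = 1 := if_pos h

theorem leftPt_mem (x : UnitIco) : leftPt x ∈ Set.Ioc (0 : ℝ) 1 := by
  have := x.2
  by_cases h : (x : ℝ) = 0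
  · rw [leftPt_of_eq_zero h]
    norm_num
  · rw [leftPt_of_ne_zero h]
    exact ⟨lt_of_le_of_ne this.1 (Ne.symm h), this.2.le⟩

theorem leftPt_injective : Function.Injective leftPt := by
  intro x y h
  have h1 := x.2.2
  have h2 := y.2.2
  apply Subtype.ext
  unfold leftPt at h
  split_ifs at h <;> linarith

theorem exists_leftPt_eq {s : ℝ} (hs : s ∈ Set.Ioc (0 : ℝ) 1) : ∃ x, leftPt x = s := by
  rcases eq_or_lt_of_le hs.2 with h | h
  · exact ⟨⟨0, by norm_num⟩, by rw [leftPt_of_eq_zero rfl, h]⟩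
  · exact ⟨⟨s, hs.1.le, h⟩, leftPt_of_ne_zero hs.1.ne'⟩

theorem eventually_leftGerm {x : UnitIco} {a : ℝ} (ha : a < leftPt x) :
    ∀ᶠ y : UnitIco in leftGerm x, a < (y : ℝ) ∧ (y : ℝ) < leftPt x :=
  mem_comap.2 ⟨_, Ioo_mem_nhdsLT ha, fun _ hy => hy⟩

theorem eventually_rightGerm {x : UnitIco} {b : ℝ} (hb : x < b) :
    ∀ᶠ y : UnitIco in rightGerm x, (x : ℝ) ≤ y ∧ (y : ℝ) < b :=
  mem_comap.2 ⟨_, Ico_mem_nhdsGE hb, fun _ hy => hy⟩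

instance leftGerm_neBot (x : UnitIco) : (leftGerm x).NeBot := by
  rw [leftGerm, comap_neBot_iff_frequently]
  refine Eventually.frequently ?_
  have h := leftPt_mem x
  filter_upwards [Ioo_mem_nhdsLT h.1] with y hy
  exact ⟨⟨y, hy.1.le, hy.2.trans_le h.2⟩, rfl⟩

theorem tendsto_val_leftGerm (x : UnitIco) :
    Tendsto Subtype.val (leftGerm x) (𝓝 (leftPt x)) :=
  tendsto_comap.mono_right nhdsWithin_le_nhds

theorem self_of_eventually_rightGerm {x : UnitIco} {p : UnitIco → Prop}
    (h : ∀ᶠ y in rightGerm x, p y) : p x := by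
  obtain ⟨s, hs, hsp⟩ := mem_comap.1 h
  exact hsp (mem_of_mem_nhdsWithin (Set.mem_Ici.2 (le_refl (x : ℝ))) hs : (x : ℝ) ∈ s)

theorem tendsto_leftGerm_unique {α : Type*} {l : Filter α} [l.NeBot] {f : α → UnitIco}
    {z w : UnitIco} (hz : Tendsto f l (leftGerm z)) (hw : Tendsto f l (leftGerm w)) : z = w :=
  leftPt_injective (tendsto_nhds_unique ((tendsto_val_leftGerm z).comp hz)
    ((tendsto_val_leftGerm w).comp hw))

theorem tendsto_leftGerm_of_translation {f : UnitIco → UnitIco} {x z : UnitIco} {t : ℝ}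
    (h : ∀ᶠ y : UnitIco in leftGerm x, (f y : ℝ) = y + t) (hz : leftPt z = leftPt x + t) :
    Tendsto f (leftGerm x) (leftGerm z) := by
  refine tendsto_comap_iff.2 (tendsto_nhdsWithin_iff.2 ⟨?_, ?_⟩)
  · rw [hz]
    exact ((tendsto_val_leftGerm x).add_const t).congr' (h.mono fun y hy => hy.symm)
  · filter_upwards [h, eventually_leftGerm (leftPt_mem x).1] with y hy hy'
    rw [Set.mem_Iio, Function.comp, hy, hz]
    linarith [hy'.2]

theorem leftPt_add_mem {f : UnitIco → UnitIco} {x : UnitIco} {t : ℝ}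
    (h : ∀ᶠ y : UnitIco in leftGerm x, (f y : ℝ) = y + t) : leftPt x + t ∈ Set.Ioc (0 : ℝ) 1 := by
  constructor
  · obtain ⟨y, hy, hy'⟩ := (h.and (eventually_leftGerm (leftPt_mem x).1)).exists
    have := (f y).2.1
    linarith [hy'.2]
  · have h1 : Tendsto (fun y => (f y : ℝ)) (leftGerm x) (𝓝 (leftPt x + t)) :=
      ((tendsto_val_leftGerm x).add_const t).congr' (h.mono fun y hy => hy.symm)
    exact le_of_tendsto h1 (Eventually.of_forall fun y => (f y).2.2.le)

theorem exists_left_translation (f : IETGroup) (x : UnitIco) :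
    ∃ t : ℝ, ∀ᶠ y : UnitIco in leftGerm x, (f.1 y : ℝ) = y + t := by
  obtain ⟨r, u, v, t, -, -, hU, ht⟩ := f.2
  have h1 : ∃ᶠ y : UnitIco in leftGerm x, ∃ i, (y : ℝ) ∈ Set.Ico (u i) (v i) :=
    (Eventually.of_forall fun y => Set.mem_iUnion.1 (hU.ge y.2)).frequently
  -- Pigeonhole on the finitely many intervals; the one met arbitrarily close to `leftPt x` contains
  -- the whole germ.
  obtain ⟨i, hi⟩ := frequently_exists.1 h1
  have hu : u i < leftPt x := by
    obtain ⟨y, hy, hy'⟩ := (hi.and_eventually (eventually_leftGerm (leftPt_mem x).1)).exists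
    exact hy.1.trans_lt hy'.2
  have hv : leftPt x ≤ v i := by
    by_contra! hlt
    obtain ⟨y, hy, hy'⟩ := (hi.and_eventually (eventually_leftGerm hlt)).exists
    exact lt_irrefl _ (hy.2.trans hy'.1)
  refine ⟨t i, (eventually_leftGerm hu).mono fun y hy => ht i y ⟨hy.1.le, hy.2.trans_le hv⟩⟩

theorem eventually_right_translation (f : IETGroup) (x : UnitIco) :
    ∀ᶠ y : UnitIco in rightGerm x, (f.1 y : ℝ) - y = f.1 x - x := by
  obtain ⟨r, u, v, t, -, -, hU, ht⟩ := f.2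
  obtain ⟨i, hi⟩ := Set.mem_iUnion.1 (hU.ge x.2)
  filter_upwards [eventually_rightGerm hi.2] with y hy
  rw [ht i x hi, ht i y ⟨hi.1.trans hy.1, hy.2⟩]
  ring

theorem tendsto_rightGerm (f : IETGroup) (x : UnitIco) :
    Tendsto f.1 (rightGerm x) (rightGerm (f.1 x)) := by
  refine tendsto_comap_iff.2 (tendsto_nhdsWithin_iff.2 ⟨?_, ?_⟩)
  · have h : Tendsto Subtype.val (rightGerm x) (𝓝 (x : ℝ)) :=
      tendsto_comap.mono_right nhdsWithin_le_nhds
    have h2 := h.add_const ((f.1 x : ℝ) - x)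
    rw [add_sub_cancel] at h2
    refine h2.congr' ((eventually_right_translation f x).mono fun y hy => ?_)
    simp only [Function.comp]
    linarith
  · filter_upwards [eventually_right_translation f x, eventually_rightGerm x.2.2] with y h1 h2
    rw [Set.mem_Ici, Function.comp]
    linarith [h2.1]

theorem exists_tendsto_leftGerm (f : IETGroup) (x : UnitIco) :
    ∃ z, Tendsto f.1 (leftGerm x) (leftGerm z) := by
  obtain ⟨t, ht⟩ := exists_left_translation f x
  obtain ⟨z, hz⟩ := exists_leftPt_eq (leftPt_add_mem ht)
  exact ⟨z, tendsto_leftGerm_of_translation ht hz⟩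

/-- The map induced on left germs by an interval exchange. -/
noncomputable def leftMap (f : IETGroup) (x : UnitIco) : UnitIco :=
  (exists_tendsto_leftGerm f x).choose

theorem tendsto_leftGerm (f : IETGroup) (x : UnitIco) :
    Tendsto f.1 (leftGerm x) (leftGerm (leftMap f x)) :=
  (exists_tendsto_leftGerm f x).choose_spec

theorem leftMap_eq {f : IETGroup} {x z : UnitIco} (h : Tendsto f.1 (leftGerm x) (leftGerm z)) :
    leftMap f x = z :=
  tendsto_leftGerm_unique (tendsto_leftGerm f x) h

theorem leftMap_one (x : UnitIco) : leftMap 1 x = x := leftMap_eq tendsto_id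

theorem leftMap_mul (f g : IETGroup) (x : UnitIco) :
    leftMap (f * g) x = leftMap f (leftMap g x) :=
  leftMap_eq ((tendsto_leftGerm f _).comp (tendsto_leftGerm g x))

/-- The action of interval exchanges on left germs. -/
noncomputable def leftAction : IETGroup →* Equiv.Perm UnitIco where
  toFun f :=
    { toFun := leftMap f
      invFun := leftMap f⁻¹
      left_inv := fun x => by rw [← leftMap_mul, inv_mul_cancel, leftMap_one]
      right_inv := fun x => by rw [← leftMap_mul, mul_inv_cancel, leftMap_one] }
  map_one' := Equiv.ext leftMap_one
  map_mul' f g := Equiv.ext (leftMap_mul f g)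

theorem leftAction_apply (f : IETGroup) (x : UnitIco) : leftAction f x = leftMap f x := rfl

/-- Away from `0` and the left end points, both germs at `x` lie in one interval and undergo the
same translation. -/
theorem finite_leftAction_ne (f : IETGroup) : {x | leftAction f x ≠ f.1 x}.Finite := by
  obtain ⟨r, u, v, t, -, -, hU, ht⟩ := f.2
  refine ((Set.finite_range u).union (Set.finite_singleton 0)).preimage
    Subtype.val_injective.injOn |>.subset ?_
  intro x hx
  by_contra hcon
  simp only [Set.mem_preimage, Set.mem_union, Set.mem_range, not_or,
    Set.mem_singleton_iff, not_exists] at hcon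
  obtain ⟨i, hi⟩ := Set.mem_iUnion.1 (hU.ge x.2)
  have hx0 := leftPt_of_ne_zero hcon.2
  have hlt : u i < leftPt x := by
    rw [hx0]
    exact lt_of_le_of_ne hi.1 (hcon.1 i)
  have hev : ∀ᶠ y : UnitIco in leftGerm x, (f.1 y : ℝ) = y + t i :=
    (eventually_leftGerm hlt).mono fun y hy => ht i y ⟨hy.1.le, hy.2.trans (hx0 ▸ hi.2)⟩
  refine hx (leftMap_eq (tendsto_leftGerm_of_translation hev ?_))
  have h1 := (leftPt_add_mem hev).1
  rw [hx0, ← ht i x hi] at h1 ⊢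
  exact leftPt_of_ne_zero h1.ne'

/-- A fixed left germ is translated by zero, so nearby points are fixed. This transfers freeness to
left germs. -/
theorem exists_fixed_of_leftAction_fixed {f : IETGroup} {x : UnitIco} (h : leftAction f x = x) :
    ∃ y, f.1 y = y := by
  obtain ⟨t, ht⟩ := exists_left_translation f x
  obtain ⟨z, hz⟩ := exists_leftPt_eq (leftPt_add_mem ht)
  have h1 : leftMap f x = z := leftMap_eq (tendsto_leftGerm_of_translation ht hz)
  rw [← leftAction_apply, h] at h1
  obtain ⟨y, hy⟩ := ht.exists
  refine ⟨y, Subtype.ext ?_⟩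
  rw [← h1] at hz
  linarith

theorem exists_mem_of_dense {D : Set UnitIco} (hD : Dense D) {x : UnitIco} {p : UnitIco → Prop}
    (h : ∀ᶠ y in rightGerm x, p y) : ∃ y ∈ D, p y := by
  obtain ⟨s, hs, hsp⟩ := mem_comap.1 h
  obtain ⟨b, hb, hbs⟩ := (mem_nhdsGE_iff_exists_Ico_subset' x.2.2).1 hs
  obtain ⟨y, hy, hyD⟩ := hD.exists_mem_open
    (isOpen_Ioo.preimage continuous_subtype_val : IsOpen (Subtype.val ⁻¹' Set.Ioo (x : ℝ) (min b 1)))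
    (by
      have hlt : (x : ℝ) < min b 1 := lt_min hb x.2.2
      obtain ⟨c, hc⟩ := exists_between hlt
      exact ⟨⟨c, x.2.1.trans hc.1.le, hc.2.trans_le (min_le_right _ _)⟩, hc⟩)
  exact ⟨y, hy, hsp (hbs ⟨hyD.1.le, hyD.2.trans_le (min_le_left _ _)⟩)⟩

/-- A function constant on right germs, and on left germs at interior points, is constant on a
half-open interval. -/
theorem eq_of_locally_constant {α : Type*} (F : UnitIco → α) {a b : UnitIco} (hab : a ≤ b)
    (hr : ∀ x, ∀ᶠ y in rightGerm x, F y = F x)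
    (hl : ∀ x, a < x → x ≤ b → ∀ᶠ y in leftGerm x, F y = F x) : F b = F a := by
  have hsub : Set.Icc (a : ℝ) b ⊆ Set.Ico (0 : ℝ) 1 := fun y hy =>
    ⟨a.2.1.trans hy.1, hy.2.trans_lt b.2.2⟩
  -- False outside `[0,1)`; this lets connectedness of a real interval be used.
  let G : ℝ → Prop := fun y => ∃ h : y ∈ Set.Ico (0 : ℝ) 1, F ⟨y, h⟩ = F a
  have hG : ∀ y : UnitIco, G y ↔ F y = F a := fun y => ⟨fun h => h.2, fun h => ⟨y.2, h⟩⟩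
  have key : ∀ y : UnitIco, a ≤ y → y ≤ b → ∀ᶠ z in 𝓝[Set.Icc (a : ℝ) b] (y : ℝ), G z ↔ G y := by
    intro y hay hyb
    have h1 : ∀ᶠ z in 𝓝[≥] (y : ℝ), z ∈ Set.Icc (a : ℝ) b → (G z ↔ G y) := by
      filter_upwards [eventually_comap.1 (hr y)] with z hz hzab
      have := hz ⟨z, hsub hzab⟩ rfl
      rw [hG y, ← this]
      exact hG ⟨z, hsub hzab⟩
    have h2 : ∀ᶠ z in 𝓝[<] (y : ℝ), z ∈ Set.Icc (a : ℝ) b → (G z ↔ G y) := by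
      rcases eq_or_lt_of_le hay with h | h
      · filter_upwards [self_mem_nhdsWithin] with z hz hzab
        exact absurd hzab.1 (not_le.2 (by rw [h]; exact hz))
      · have h0 : (y : ℝ) ≠ 0 := (a.2.1.trans_lt h).ne'
        have := hl y h hyb
        rw [leftGerm, leftPt_of_ne_zero h0] at this
        filter_upwards [eventually_comap.1 this] with z hz hzab
        have := hz ⟨z, hsub hzab⟩ rfl
        rw [hG y, ← this]
        exact hG ⟨z, hsub hzab⟩
    have h3 : ∀ᶠ z in 𝓝 (y : ℝ), z ∈ Set.Icc (a : ℝ) b → (G z ↔ G y) := by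
      rw [← nhdsLT_sup_nhdsGE]
      exact eventually_sup.2 ⟨h2, h1⟩
    exact eventually_nhdsWithin_iff.2 h3
  have := isPreconnected_Icc.induction₂ (s := Set.Icc (a : ℝ) b) (fun y z => (G z ↔ G y))
    (fun y hy => key ⟨y, hsub hy⟩ hy.1 hy.2) (fun x y z _ _ _ h1 h2 => h2.trans h1)
    (fun x y _ _ h => h.symm) (Set.left_mem_Icc.2 hab) (Set.right_mem_Icc.2 hab)
  exact (hG b).1 (this.2 ((hG a).2 rfl))

/-- An interval exchange that is continuous on the circle is a rotation. -/
theorem isRotation_of_leftAction_eq {f : IETGroup} (hf : ∀ x, leftAction f x = f.1 x) :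
    IsRotation f := by
  have hfr : ∀ x, ∃ n : ℤ, leftPt x = x + n := by
    intro x
    by_cases h : (x : ℝ) = 0
    · exact ⟨1, by rw [leftPt_of_eq_zero h, h]; norm_num⟩
    · exact ⟨0, by rw [leftPt_of_ne_zero h]; norm_num⟩
  -- The displacement modulo 1. By `hf` it does not jump across any point of the circle.
  let F : UnitIco → ℝ := fun x => Int.fract ((f.1 x : ℝ) - x)
  have hr : ∀ x, ∀ᶠ y in rightGerm x, F y = F x := fun x =>
    (eventually_right_translation f x).mono fun y hy => by simp only [F, hy]
  have hl : ∀ x, ∀ᶠ y in leftGerm x, F y = F x := by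
    intro x
    obtain ⟨t, ht⟩ := exists_left_translation f x
    obtain ⟨z, hz⟩ := exists_leftPt_eq (leftPt_add_mem ht)
    have h1 : leftMap f x = z := leftMap_eq (tendsto_leftGerm_of_translation ht hz)
    rw [← leftAction_apply, hf] at h1
    rw [← h1] at hz
    obtain ⟨n, hn⟩ := hfr x
    obtain ⟨m, hm⟩ := hfr (f.1 x)
    refine ht.mono fun y hy => ?_
    simp only [F]
    rw [Int.fract_eq_fract]
    refine ⟨m - n, ?_⟩
    push_cast
    linarith
  let o : UnitIco := ⟨0, by norm_num⟩
  have hconst : ∀ x, F x = F o := fun x =>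
    eq_of_locally_constant F (show (0 : ℝ) ≤ x from x.2.1) hr fun y _ _ => hl y
  refine ⟨F o, fun x => ?_⟩
  rw [← hconst x]
  have h1 : Int.fract ((f.1 x : ℝ)) = f.1 x := Int.fract_eq_self.2 (f.1 x).2
  rw [← h1, Int.fract_eq_fract]
  refine ⟨⌊(f.1 x : ℝ) - x⌋, ?_⟩
  simp only [F, Int.fract]
  ring

end Germs

end IntervalExchange

namespace IntervalExchange

open Filter Topology

/-! ### Cutting and regluing the circle -/

section Regluing

theorem exists_index_Ico (c : ℕ → ℝ) {k : ℕ} {x : ℝ} (h0 : c 0 ≤ x) (hk : x < c k) :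
    ∃ j < k, x ∈ Set.Ico (c j) (c (j + 1)) := by
  induction k with
  | zero => exact absurd hk (not_lt.2 h0)
  | succ k ih =>
    by_cases h : x < c k
    · obtain ⟨j, hj, hx⟩ := ih h
      exact ⟨j, by omega, hx⟩
    · exact ⟨k, by omega, not_lt.1 h, hk⟩

theorem exists_index_Ioc (c : ℕ → ℝ) {k : ℕ} {x : ℝ} (h0 : c 0 < x) (hk : x ≤ c k) :
    ∃ j < k, x ∈ Set.Ioc (c j) (c (j + 1)) := by
  induction k with
  | zero => exact absurd h0 (not_lt.2 hk)
  | succ k ih =>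
    by_cases h : x ≤ c k
    · obtain ⟨j, hj, hx⟩ := ih h
      exact ⟨j, by omega, hx⟩
    · exact ⟨k, by omega, not_le.1 h, hk⟩

theorem index_Ico_unique {c : ℕ → ℝ} (hc : StrictMono c) {i j : ℕ} {x : ℝ}
    (hi : x ∈ Set.Ico (c i) (c (i + 1))) (hj : x ∈ Set.Ico (c j) (c (j + 1))) : i = j := by
  have h1 := hc.lt_iff_lt.1 (hi.1.trans_lt hj.2)
  have h2 := hc.lt_iff_lt.1 (hj.1.trans_lt hi.2)
  omega

/-- Finitely many points of `[0,1)` are among the left end points of a partition into intervals. -/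
theorem exists_cuts {B : Set UnitIco} (hB : B.Finite) :
    ∃ (k : ℕ) (c : ℕ → ℝ), StrictMono c ∧ c 0 = 0 ∧ c k = 1 ∧ ∀ x ∈ B, ∃ i, (x : ℝ) = c i := by
  classical
  let S : Finset ℝ := insert 0 (insert 1 (hB.toFinset.image Subtype.val))
  have hS : ∀ s ∈ S, 0 ≤ s ∧ s ≤ 1 := by
    intro s hs
    simp only [S, Finset.mem_insert, Finset.mem_image] at hs
    rcases hs with rfl | rfl | ⟨x, -, rfl⟩
    · norm_num
    · norm_num
    · exact ⟨x.2.1, x.2.2.le⟩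
  have h0 : (0 : ℝ) ∈ S := by simp [S]
  have h1 : (1 : ℝ) ∈ S := by simp [S]
  have hpos : 0 < S.card := Finset.card_pos.2 ⟨0, h0⟩
  let o := S.orderEmbOfFin rfl
  have ho : ∀ i, o i ∈ S := fun i => S.orderEmbOfFin_mem rfl i
  -- The values past the last cut only serve to keep `c` strictly increasing on all of `ℕ`.
  let c : ℕ → ℝ := fun j => if h : j < S.card then o ⟨j, h⟩ else 1 + j
  have hc : ∀ (j : ℕ) (h : j < S.card), c j = o ⟨j, h⟩ := fun j h => dif_pos h
  have hc' : ∀ j, ¬ j < S.card → c j = 1 + j := fun j h => dif_neg h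
  refine ⟨S.card - 1, c, strictMono_nat_of_lt_succ fun j => ?_, ?_, ?_, ?_⟩
  · by_cases h : j + 1 < S.card
    · rw [hc _ h, hc _ (Nat.lt_of_succ_lt h)]
      exact o.strictMono (Nat.lt_succ_self j)
    · rw [hc' _ h]
      push_cast
      by_cases h' : j < S.card
      · rw [hc _ h']
        linarith [(hS _ (ho ⟨j, h'⟩)).2, (Nat.cast_nonneg j : (0 : ℝ) ≤ j)]
      · rw [hc' _ h']
        linarith
  · rw [hc _ hpos, Finset.orderEmbOfFin_zero rfl hpos]
    exact le_antisymm (Finset.min'_le _ _ h0) (hS _ (Finset.min'_mem _ _)).1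
  · rw [hc _ (by omega), Finset.orderEmbOfFin_last rfl hpos]
    exact le_antisymm (hS _ (Finset.max'_mem _ _)).2 (Finset.le_max' _ _ h1)
  · intro x hx
    have hxS : (x : ℝ) ∈ Set.range o := by
      rw [Finset.range_orderEmbOfFin]
      simp only [S, Finset.coe_insert, Finset.coe_image, Set.Finite.coe_toFinset]
      exact Or.inr (Or.inr ⟨x, hx, rfl⟩)
    obtain ⟨i, hi⟩ := hxS
    exact ⟨i, by rw [hc _ i.2, ← hi]⟩

/-- Two partitions of `[0,1)` into intervals of the same lengths define an interval exchange. -/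
theorem exists_iet_of_partitions {ι : Type} [Finite ι] (u v u' v' : ι → ℝ)
    (hd : ∀ i j x, x ∈ Set.Ico (u i) (v i) → x ∈ Set.Ico (u j) (v j) → i = j)
    (hU : (⋃ i, Set.Ico (u i) (v i)) = Set.Ico (0 : ℝ) 1)
    (hd' : ∀ i j x, x ∈ Set.Ico (u' i) (v' i) → x ∈ Set.Ico (u' j) (v' j) → i = j)
    (hU' : (⋃ i, Set.Ico (u' i) (v' i)) = Set.Ico (0 : ℝ) 1)
    (hlen : ∀ i, v i - u i = v' i - u' i) :
    ∃ φ : IETGroup, ∀ i (x : UnitIco), (x : ℝ) ∈ Set.Ico (u i) (v i) →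
      (φ.1 x : ℝ) = x + (u' i - u i) := by
  have hidx : ∀ x : UnitIco, ∃ i, (x : ℝ) ∈ Set.Ico (u i) (v i) := fun x =>
    Set.mem_iUnion.1 (hU.ge x.2)
  choose ix hix using hidx
  have hmem : ∀ (i : ι) (x : ℝ), x ∈ Set.Ico (u i) (v i) →
      x + (u' i - u i) ∈ Set.Ico (u' i) (v' i) := fun i x hx =>
    ⟨by linarith [hx.1], by linarith [hx.2, hlen i]⟩
  let f : UnitIco → UnitIco := fun x =>
    ⟨x + (u' (ix x) - u (ix x)), hU'.le (Set.mem_iUnion.2 ⟨_, hmem _ _ (hix x)⟩)⟩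
  have hf : ∀ i (x : UnitIco), (x : ℝ) ∈ Set.Ico (u i) (v i) → (f x : ℝ) = x + (u' i - u i) := by
    intro i x hx
    rw [← hd _ _ _ (hix x) hx]
  have hbij : Function.Bijective f := by
    constructor
    · intro x y hxy
      have h1 := hmem _ _ (hix x)
      have h2 := hmem _ _ (hix y)
      rw [← hf _ x (hix x)] at h1
      rw [← hf _ y (hix y), ← hxy] at h2
      have h3 := hd' _ _ _ h1 h2
      have h4 := hf _ x (hix x)
      rw [hxy, hf _ y (hix y), h3] at h4
      exact Subtype.ext (by linarith)
    · intro y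
      obtain ⟨i, hi⟩ := Set.mem_iUnion.1 (hU'.ge y.2)
      have hm : (y : ℝ) - (u' i - u i) ∈ Set.Ico (u i) (v i) :=
        ⟨by linarith [hi.1], by linarith [hi.2, hlen i]⟩
      refine ⟨⟨_, hU.le (Set.mem_iUnion.2 ⟨i, hm⟩)⟩, Subtype.ext ?_⟩
      rw [hf i _ hm]
      ring
  refine ⟨⟨Equiv.ofBijective f hbij, isIET_of_finite _ u v (fun i => u' i - u i) ?_ hU hf⟩, hf⟩
  intro i j hij
  exact Set.disjoint_left.2 fun x hx hx' => hij (hd i j x hx hx')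

/-- If the circle cut at finitely many points and reglued by `τ` is connected, then
an interval exchange identifies it with the standard circle. -/
theorem exists_iet_leftAction_eq (τ : Equiv.Perm UnitIco) (hτ : {x | τ x ≠ x}.Finite)
    (hconn : ∀ F : UnitIco → Prop, (∀ x, ∀ᶠ y in rightGerm x, F y = F x) →
      (∀ x, ∀ᶠ y in leftGerm x, F y = F (τ x)) → ∀ x y, F x = F y) :
    ∃ φ : IETGroup, ∀ x, leftAction φ x = φ.1 (τ x) := by
  classical
  obtain ⟨k, c, hc, hc0, hck, hcB⟩ := exists_cuts hτ
  have hk : 0 < k := by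
    rcases Nat.eq_zero_or_pos k with rfl | h
    · exact absurd (hc0.symm.trans hck) (by norm_num)
    · exact h
  have hcI : ∀ i : Fin k, c i ∈ Set.Ico (0 : ℝ) 1 := fun i =>
    ⟨hc0 ▸ hc.monotone (Nat.zero_le _), hck ▸ hc i.2⟩
  have hcI' : ∀ i : Fin k, c (i + 1) ∈ Set.Ioc (0 : ℝ) 1 := fun i =>
    ⟨hc0 ▸ hc (Nat.succ_pos _), hck ▸ hc.monotone i.2⟩
  let p : Fin k → UnitIco := fun i => ⟨c i, hcI i⟩
  have hcut : ∀ (x : UnitIco) (i : ℕ), (x : ℝ) = c i → ∃ j, x = p j := by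
    intro x i hi
    have hik : i < k := hc.lt_iff_lt.1 (by rw [hck, ← hi]; exact x.2.2)
    exact ⟨⟨i, hik⟩, Subtype.ext hi⟩
  choose q hq using fun i : Fin k => exists_leftPt_eq (hcI' i)
  -- The right end of each piece is glued to the left end of a piece: either `τ` fixes it, or its
  -- image is again moved by `τ` and hence a cut.
  have hπ : ∀ i, ∃ j, τ (q i) = p j := by
    intro i
    by_cases h : τ (q i) = q i
    · rw [h]
      by_cases h0 : (q i : ℝ) = 0
      · exact hcut _ 0 (h0.trans hc0.symm)
      · exact hcut _ (i + 1) (by rw [← hq i, leftPt_of_ne_zero h0])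
    · obtain ⟨j, hj⟩ := hcB (τ (q i)) fun h' => h (τ.injective h')
      exact hcut _ j hj
  choose π hπ using hπ
  have hπinj : Function.Injective π := by
    intro i j hij
    have h1 : q i = q j := τ.injective (by rw [hπ, hπ, hij])
    have h2 := hq i
    rw [h1, hq j] at h2
    have := hc.injective h2
    exact Fin.ext (by omega)
  let σ : Equiv.Perm (Fin k) := Equiv.ofBijective π (Finite.injective_iff_bijective.1 hπinj)
  have hσ : ∀ i, τ (q i) = p (σ i) := hπ
  have hpmem : ∀ i : Fin k, (p i : ℝ) ∈ Set.Ico (c i) (c (i + 1)) := fun i =>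
    ⟨le_rfl, hc (Nat.lt_succ_self _)⟩
  have huniq : ∀ (i j : Fin k) (x : ℝ), x ∈ Set.Ico (c i) (c (i + 1)) →
      x ∈ Set.Ico (c j) (c (j + 1)) → i = j := fun i j x hi hj =>
    Fin.ext (index_Ico_unique hc hi hj)
  have hidx : ∀ x : UnitIco, ∃ i : Fin k, (x : ℝ) ∈ Set.Ico (c i) (c (i + 1)) := by
    intro x
    obtain ⟨i, hi, hx⟩ := exists_index_Ico c (k := k) (hc0.trans_le x.2.1) (x.2.2.trans_eq hck.symm)
    exact ⟨⟨i, hi⟩, hx⟩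
  have hidx' : ∀ x : UnitIco, ∃ i : Fin k, c i < leftPt x ∧
      (∀ᶠ y : UnitIco in leftGerm x, (y : ℝ) ∈ Set.Ico (c i) (c (i + 1))) ∧
      ((leftPt x = c (i + 1) ∧ τ x = p (σ i)) ∨
        ((x : ℝ) = leftPt x ∧ τ x = x ∧ (x : ℝ) ∈ Set.Ico (c i) (c (i + 1)))) := by
    intro x
    obtain ⟨i, hi, hx⟩ := exists_index_Ioc c (k := k) (hc0 ▸ (leftPt_mem x).1)
      (hck ▸ (leftPt_mem x).2)
    refine ⟨⟨i, hi⟩, hx.1, ?_, ?_⟩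
    · filter_upwards [eventually_leftGerm hx.1] with y hy
      exact ⟨hy.1.le, hy.2.trans_le hx.2⟩
    · rcases eq_or_lt_of_le hx.2 with h | h
      · refine Or.inl ⟨h, ?_⟩
        rw [← hσ, leftPt_injective (h.trans (hq ⟨i, hi⟩).symm)]
      · refine Or.inr ?_
        have h0 : (x : ℝ) ≠ 0 := by
          intro h0
          rw [leftPt_of_eq_zero h0, ← hck] at h
          have := hc.lt_iff_lt.1 h
          omega
        rw [leftPt_of_ne_zero h0] at h hx ⊢
        refine ⟨rfl, ?_, hx.1.le, h⟩
        by_contra hne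
        obtain ⟨j, hj⟩ := hcB x hne
        rw [hj] at h hx
        have h1 := hc.lt_iff_lt.1 h
        have h2 := hc.lt_iff_lt.1 hx.1
        omega
  let i₀ : Fin k := ⟨0, hk⟩
  have hcycle : ∀ i, σ.SameCycle i₀ i := by
    -- The union of the pieces in one cycle of `σ` is a component of the reglued space, so by
    -- `hconn` it is everything.
    let F : UnitIco → Prop := fun x => ∃ i : Fin k,
      (x : ℝ) ∈ Set.Ico (c i) (c (i + 1)) ∧ σ.SameCycle i₀ i
    have hF : ∀ (i : Fin k) (x : UnitIco), (x : ℝ) ∈ Set.Ico (c i) (c (i + 1)) →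
        F x = σ.SameCycle i₀ i := fun i x hx => propext
      ⟨fun ⟨j, hj, hs⟩ => huniq _ _ _ hj hx ▸ hs, fun hs => ⟨i, hx, hs⟩⟩
    intro i
    rw [← hF i (p i) (hpmem i), hconn F ?_ ?_ (p i) (p i₀), hF i₀ (p i₀) (hpmem i₀)]
    · intro x
      obtain ⟨i, hi⟩ := hidx x
      filter_upwards [eventually_rightGerm hi.2] with y hy
      rw [hF i x hi, hF i y ⟨hi.1.trans hy.1, hy.2⟩]
    · intro x
      obtain ⟨i, -, hev, h⟩ := hidx' x
      filter_upwards [hev] with y hy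
      rw [hF i y hy]
      rcases h with ⟨-, h⟩ | ⟨-, h, hx⟩
      · rw [h, hF _ _ (hpmem (σ i)), Equiv.Perm.sameCycle_apply_right]
      · rw [h, hF i x hx]
  have hon : σ.IsCycleOn (Finset.univ : Finset (Fin k)) :=
    ⟨by simp, fun i _ j _ => (hcycle i).symm.trans (hcycle j)⟩
  -- The pieces in the order in which the single cycle runs through them; `φ` will place the `j`-th
  -- one at the partial sum `s j` of lengths.
  let a : ℕ → Fin k := fun j => (σ ^ j) i₀
  have ha_succ : ∀ j, a (j + 1) = σ (a j) := fun j => by simp only [a, pow_succ', Equiv.Perm.mul_apply]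
  have hak : a k = i₀ := by
    have := hon.pow_card_apply (Finset.mem_univ i₀)
    rwa [Finset.card_univ, Fintype.card_fin] at this
  have hasurj : Function.Surjective fun j : Fin k => a j := by
    intro i
    obtain ⟨n, hn, h⟩ := hon.exists_pow_eq (Finset.mem_univ i₀) (Finset.mem_univ i)
    rw [Finset.card_univ, Fintype.card_fin] at hn
    exact ⟨⟨n, hn⟩, h⟩
  have habij : Function.Bijective fun j : Fin k => a j := Finite.surjective_iff_bijective.1 hasurj
  let s : ℕ → ℝ := fun j => ∑ m ∈ Finset.range j, (c (a m + 1) - c (a m))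
  have hs_succ : ∀ j, s (j + 1) = s j + (c (a j + 1) - c (a j)) := fun j =>
    Finset.sum_range_succ _ _
  have hs : StrictMono s := strictMono_nat_of_lt_succ fun j => by
    rw [hs_succ]
    linarith [hc (Nat.lt_succ_self (a j))]
  have hs0 : s 0 = 0 := Finset.sum_range_zero _
  have hsk : s k = 1 := by
    have h1 : s k = ∑ m : Fin k, (c (a m + 1) - c (a m)) :=
      Finset.sum_range fun m => c (a m + 1) - c (a m)
    rw [h1, habij.sum_comp fun i : Fin k => c (i + 1) - c i,
      ← Finset.sum_range fun i => c (i + 1) - c i, Finset.sum_range_sub, hc0, hck, sub_zero]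
  obtain ⟨φ, hφ⟩ := exists_iet_of_partitions (fun m : Fin k => c (a m)) (fun m => c (a m + 1))
    (fun m => s m) (fun m => s (m + 1)) (fun i j x hi hj => habij.1 (huniq _ _ x hi hj))
    (by
      ext x
      simp only [Set.mem_iUnion]
      constructor
      · rintro ⟨m, hm⟩
        exact ⟨(hcI _).1.trans hm.1, hm.2.trans_le (hcI' _).2⟩
      · intro hx
        obtain ⟨i, hi⟩ := hidx ⟨x, hx⟩
        obtain ⟨m, rfl⟩ := hasurj i
        exact ⟨m, hi⟩)
    (fun i j x hi hj => Fin.ext (index_Ico_unique hs hi hj))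
    (by
      ext x
      simp only [Set.mem_iUnion]
      constructor
      · rintro ⟨m, hm⟩
        exact ⟨(hs0.symm.trans_le (hs.monotone (Nat.zero_le _))).trans hm.1,
          hm.2.trans_le (hsk ▸ hs.monotone m.2)⟩
      · intro hx
        obtain ⟨m, hm, h⟩ := exists_index_Ico s (k := k) (hs0 ▸ hx.1) (hsk ▸ hx.2)
        exact ⟨⟨m, hm⟩, h⟩)
    (fun m => by rw [hs_succ]; ring)
  refine ⟨φ, fun x => ?_⟩
  obtain ⟨i, hlt, hev, h⟩ := hidx' x
  obtain ⟨m, rfl⟩ := hasurj i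
  refine leftMap_eq (tendsto_leftGerm_of_translation (hev.mono fun y hy => hφ m y hy) ?_)
  have hsm : 0 ≤ s m := hs0 ▸ hs.monotone (Nat.zero_le _)
  rcases h with ⟨h, hx⟩ | ⟨h, hx, hmem⟩
  · rw [hx, ← ha_succ, h]
    have h2 : c (a m + 1) + (s m - c (a m)) = s (m + 1) := by rw [hs_succ]; ring
    rw [h2]
    -- The last piece ends at `1` and is followed by the first, which starts at `0`; this matches
    -- since `leftPt` of `0` is `1`.
    rcases eq_or_lt_of_le (Nat.succ_le_of_lt m.2) with hm | hm
    · have hm' : (m : ℕ) + 1 = k := hm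
      rw [hm', hak, hsk]
      refine leftPt_of_eq_zero ?_
      have := hφ i₀ (p i₀) (hpmem i₀)
      rw [this]
      change c 0 + (s 0 - c 0) = 0
      rw [hs0]
      ring
    · have h3 := hφ ⟨m + 1, hm⟩ (p (a (m + 1))) (hpmem _)
      have h4 : (φ.1 (p (a (m + 1))) : ℝ) = s (m + 1) := by
        rw [h3]
        change c (a (m + 1)) + (s (m + 1) - c (a (m + 1))) = s (m + 1)
        ring
      rw [leftPt_of_ne_zero, h4]
      rw [h4, ← hs0]
      exact (hs (Nat.succ_pos m)).ne'
  · have h3 := hφ m x hmem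
    rw [hx, leftPt_of_ne_zero, h3, ← h]
    rw [h3, h]
    simp only at hlt ⊢
    linarith

end Regluing

end IntervalExchange

namespace IntervalExchange

open Filter Topology

/-! ### Consequences of minimality, and the rank two subgroup -/

section Minimality

variable {Γ : Type*} [Group Γ]

/-- An element centralizing a minimal group of interval exchanges acts freely or trivially. -/
theorem eq_one_of_fixed (ρ : Γ →* IETGroup) (hfaithful : Function.Injective ρ) {A : Subgroup Γ}
    (hmin : ActsMinimally ρ A) {z : Γ} (hz : ∀ a ∈ A, a * z = z * a) {x : UnitIco}
    (hx : (ρ z).1 x = x) : z = 1 := by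
  refine hfaithful (Subtype.ext (Equiv.ext fun y => ?_))
  -- `z` fixes the whole orbit of `x`, which comes close enough to `y` from the right to have the
  -- same displacement under `z`.
  obtain ⟨w, ⟨a, ha, rfl⟩, hw⟩ := exists_mem_of_dense (hmin x)
    (eventually_right_translation (ρ z) y)
  have h1 : (ρ z).1 ((ρ a).1 x) = (ρ a).1 x := by
    have h2 : (ρ z).1 * (ρ a).1 = (ρ a).1 * (ρ z).1 :=
      congrArg Subtype.val (by rw [← map_mul, ← map_mul, hz a ha] : ρ z * ρ a = ρ a * ρ z)
    have h3 := congrArg (fun g : Equiv.Perm UnitIco => g x) h2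
    simpa only [Equiv.Perm.mul_apply, hx] using h3
  rw [h1, sub_self] at hw
  rw [map_one]
  exact Subtype.ext (sub_eq_zero.1 hw.symm)

/-- Such an `F` is constant on each piece between cuts, so its values at the finitely many left end
points determine it. -/
theorem finite_locally_constant {τ : Equiv.Perm UnitIco} (hτ : {x | τ x ≠ x}.Finite) :
    {F : UnitIco → Prop | (∀ x, ∀ᶠ y in rightGerm x, F y = F x) ∧
      ∀ x, ∀ᶠ y in leftGerm x, F y = F (τ x)}.Finite := by
  obtain ⟨k, c, hc, hc0, hck, hcB⟩ := exists_cuts hτ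
  have hcI : ∀ i : Fin k, c i ∈ Set.Ico (0 : ℝ) 1 := fun i =>
    ⟨hc0 ▸ hc.monotone (Nat.zero_le _), hck ▸ hc i.2⟩
  let p : Fin k → UnitIco := fun i => ⟨c i, hcI i⟩
  refine Set.Finite.of_injOn (f := fun (F : UnitIco → Prop) (i : Fin k) => F (p i))
    (Set.mapsTo_univ _ _) ?_ Set.finite_univ
  have hconst : ∀ F : UnitIco → Prop, (∀ x, ∀ᶠ y in rightGerm x, F y = F x) →
      (∀ x, ∀ᶠ y in leftGerm x, F y = F (τ x)) → ∀ (i : Fin k) (x : UnitIco),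
      (x : ℝ) ∈ Set.Ico (c i) (c (i + 1)) → F x = F (p i) := by
    intro F hr hl i x hx
    refine eq_of_locally_constant F (show c i ≤ (x : ℝ) from hx.1) hr fun y hy hyx => ?_
    have h1 : τ y = y := by
      by_contra hne
      obtain ⟨j, hj⟩ := hcB y hne
      have h2 : c i < (y : ℝ) := hy
      have h3 : (y : ℝ) < c (i + 1) := lt_of_le_of_lt hyx hx.2
      rw [hj] at h2 h3
      have := hc.lt_iff_lt.1 h2
      have := hc.lt_iff_lt.1 h3
      omega
    have h2 := hl y
    rwa [h1] at h2
  rintro F ⟨hr, hl⟩ G ⟨hr', hl'⟩ hFG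
  funext x
  obtain ⟨i, hi, hx⟩ := exists_index_Ico c (k := k) (hc0.trans_le x.2.1) (x.2.2.trans_eq hck.symm)
  rw [hconst F hr hl ⟨i, hi⟩ x hx, hconst G hr' hl' ⟨i, hi⟩ x hx]
  exact congrFun hFG ⟨i, hi⟩

/-- An equivariantly reglued circle is connected if the action is totally minimal. -/
theorem locally_constant_eq_of_isTotallyMinimal (ρ : Γ →* IETGroup) (hmin : IsTotallyMinimal ρ)
    {τ : Equiv.Perm UnitIco} (hτ : {x | τ x ≠ x}.Finite)
    (heq : ∀ γ x, τ (leftAction (ρ γ) x) = (ρ γ).1 (τ x)) (F : UnitIco → Prop)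
    (hr : ∀ x, ∀ᶠ y in rightGerm x, F y = F x)
    (hl : ∀ x, ∀ᶠ y in leftGerm x, F y = F (τ x)) (x y : UnitIco) : F x = F y := by
  have hmul : ∀ a b x, (ρ (a * b)).1 x = (ρ a).1 ((ρ b).1 x) := fun a b x => by
    rw [map_mul]
    rfl
  have hone : ∀ x, (ρ 1).1 x = x := fun x => by
    rw [map_one]
    rfl
  -- The stabilizer of `F`. By `heq`, `Γ` permutes the finite set of functions compatible with the
  -- gluing, so its index is finite.
  let H : Subgroup Γ :=
    { carrier := {γ | ∀ x, F ((ρ γ).1 x) = F x}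
      one_mem' := fun x => by rw [hone]
      mul_mem' := fun {a b} ha hb x => by rw [hmul, ha, hb]
      inv_mem' := fun {a} ha x => by rw [← ha, ← hmul, mul_inv_cancel, hone] }
  have hH : H.FiniteIndex := by
    have := (finite_locally_constant hτ).to_subtype
    have hfin : Finite (Γ ⧸ H) := by
      refine Finite.of_injective (β := {F : UnitIco → Prop |
        (∀ x, ∀ᶠ y in rightGerm x, F y = F x) ∧ ∀ x, ∀ᶠ y in leftGerm x, F y = F (τ x)})
        (fun q => ⟨fun x => F ((ρ q.out⁻¹).1 x), fun x => ?_, fun x => ?_⟩) ?_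
      · exact (tendsto_rightGerm (ρ q.out⁻¹) x).eventually (hr _)
      · simp only [← heq]
        exact (tendsto_leftGerm (ρ q.out⁻¹) x).eventually (hl _)
      · intro q q' h
        have h1 := congrArg Subtype.val h
        rw [← QuotientGroup.out_eq' q, ← QuotientGroup.out_eq' q']
        refine QuotientGroup.eq.2 fun x => ?_
        have h2 := congrFun h1 ((ρ q'.out).1 x)
        simp only [← hmul] at h2
        rw [inv_mul_cancel, hone] at h2
        exact h2
    exact Subgroup.finiteIndex_of_finite_quotient
  obtain ⟨w, ⟨γ, hγ, rfl⟩, hw⟩ := exists_mem_of_dense (hmin H hH y) (hr x)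
  rw [← hw]
  exact hγ y

end Minimality

/-- Two commuting elements of infinite order in a finite index subgroup, spanning `ℤ²`. -/
theorem exists_rank_two_of_containsZSquared {Γ : Type*} [Group Γ] (hZ : ContainsZSquared Γ)
    (A : Subgroup Γ) [hA : A.FiniteIndex] :
    ∃ f ∈ A, ∃ g ∈ A, ∀ m n : ℤ, f ^ m * g ^ n = 1 → m = 0 ∧ n = 0 := by
  obtain ⟨K, ⟨e⟩⟩ := hZ
  obtain ⟨i, hi, -, hf⟩ := Subgroup.exists_pow_mem_of_index_ne_zero hA.index_ne_zero
    (e (Multiplicative.ofAdd (1, 0)) : Γ)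
  obtain ⟨j, hj, -, hg⟩ := Subgroup.exists_pow_mem_of_index_ne_zero hA.index_ne_zero
    (e (Multiplicative.ofAdd (0, 1)) : Γ)
  refine ⟨_, hf, _, hg, fun m n h => ?_⟩
  have h1 : (Multiplicative.ofAdd ((1 : ℤ), (0 : ℤ)) ^ i) ^ m *
      (Multiplicative.ofAdd ((0 : ℤ), (1 : ℤ)) ^ j) ^ n = 1 := by
    apply e.injective
    apply Subtype.ext
    simpa using h
  have h2 := congrArg Multiplicative.toAdd h1
  simp only [toAdd_mul, toAdd_zpow, toAdd_pow, toAdd_ofAdd, toAdd_one, Prod.ext_iff, Prod.fst_add,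
    Prod.snd_add, Prod.smul_fst, Prod.smul_snd, Prod.fst_zero, Prod.snd_zero] at h2
  simp only [smul_eq_mul, nsmul_eq_mul, mul_zero, mul_one, add_zero, zero_add] at h2
  have hi' : (i : ℤ) ≠ 0 := by exact_mod_cast hi.ne'
  have hj' : (j : ℤ) ≠ 0 := by exact_mod_cast hj.ne'
  exact ⟨(mul_eq_zero.1 h2.1).resolve_right hi', (mul_eq_zero.1 h2.2).resolve_right hj'⟩

end IntervalExchange

/-! ### Assembling the conjugacy -/

open IntervalExchange in
theorem corollary1 {Γ : Type*} [Group Γ]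
    (hab : IntervalExchange.IsVirtuallyAbelian Γ)
    (hZ : IntervalExchange.ContainsZSquared Γ)
    (ρ : Γ →* IntervalExchange.IETGroup)
    (hfaithful : Function.Injective ρ)
    (hmin : IntervalExchange.IsTotallyMinimal ρ) :
    ∃ σ : Γ →* IntervalExchange.IETGroup,
      (∀ γ : Γ, IntervalExchange.IsRotation (σ γ)) ∧ IntervalExchange.AreConjugate ρ σ := by
  obtain ⟨H, hH, hcomm⟩ := hab
  have hA : ∀ a ∈ H.normalCore, ∀ b ∈ H.normalCore, a * b = b * a := fun a ha b hb =>
    hcomm a (H.normalCore_le ha) b (H.normalCore_le hb)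
  obtain ⟨f, hf, g, hg, hfg⟩ := exists_rank_two_of_containsZSquared hZ H.normalCore
  have hfree : ∀ (m n : ℤ) (x : UnitIco), (ρ (f ^ m * g ^ n)).1 x = x → m = 0 ∧ n = 0 := by
    intro m n x hx
    have hmem : f ^ m * g ^ n ∈ H.normalCore := mul_mem (zpow_mem hf m) (zpow_mem hg n)
    exact hfg m n (eq_one_of_fixed ρ hfaithful (hmin H.normalCore inferInstance)
      (fun a ha => hA a ha _ hmem) hx)
  obtain ⟨τ, hτ, heq⟩ := exists_finite_support_intertwiner (leftAction.comp ρ)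
    (IETGroup.subtype.comp ρ) (fun γ => finite_leftAction_ne (ρ γ)) H.normalCore hA f g hf hg
    (fun m n x hx => by
      obtain ⟨y, hy⟩ := exists_fixed_of_leftAction_fixed hx
      exact hfree m n y hy) hfree
  obtain ⟨φ, hφ⟩ := exists_iet_leftAction_eq τ hτ
    (locally_constant_eq_of_isTotallyMinimal ρ hmin hτ heq)
  refine ⟨(MulAut.conj φ).toMonoidHom.comp ρ, fun γ => isRotation_of_leftAction_eq fun x => ?_,
    φ, fun γ => rfl⟩
  -- At the left germ `leftAction φ w`, which equals `φ.1 (τ w)`, equality of the two conjugated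
  -- actions is the intertwining relation for `τ`.
  obtain ⟨w, rfl⟩ := (leftAction φ).surjective x
  change leftAction (φ * ρ γ * φ⁻¹) (leftAction φ w) = (φ * ρ γ * φ⁻¹).1 (leftAction φ w)
  have h1 : leftAction (φ * ρ γ * φ⁻¹) (leftAction φ w) = leftAction φ (leftAction (ρ γ) w) := by
    rw [← Equiv.Perm.mul_apply, ← map_mul, inv_mul_cancel_right, map_mul, Equiv.Perm.mul_apply]
  have h2 : (φ * ρ γ * φ⁻¹).1 (φ.1 (τ w)) = φ.1 ((ρ γ).1 (τ w)) := by
    change ((φ * ρ γ * φ⁻¹) * φ).1 (τ w) = _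
    rw [inv_mul_cancel_right]
    rfl
  rw [h1, hφ w, h2, hφ]
  exact congrArg φ.1 (heq γ w)
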